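/- **Setting.** For real symmetric matrices write $X\preccurlyeq Y$ if $Y-X$ is positive semidefinite, and let $X^{+}$ be the Moore–Penrose pseudo-inverse. An $\mathrm{SDDM}_0$-matrix is a symmetric matrix with $A_{jj}\ge\sum_{h\ne j}|A_{jh}|$ for all $j$ and non-positive off-diagonal entries; a matrix is irreducible if no simultaneous permutation of rows and columns makes it block diagonal with at least two blocks. A function $\mathbb R^n\to\mathbb R^n$ is a symmetric linear operator if it is $\mathbf b\mapsto M\mathbf b$ for a symmetric matrix $M$, with which it is then identified. *Preconditioned Chebyshev method.* Given a matrix $A$, a vector $\mathbf b$, a number of rounds $t$, a function $f$ and $\lambda_{\min},\lambda_{\max}$, put $d=(\lambda_{\max}+\lambda_{\min})/2$, $c=(\lambda_{\max}-\lambda_{\min})/2$, $\mathbf x=0$, $\mathbf r=\mathbf b$. For $j=1,\dots,t$: set $\mathbf z=f(\mathbf r)$; if $j=1$, set $\mathbf p=\mathbf z$, $\alpha=1/d$; otherwise set $\beta=(c\alpha)^2/2$ if $j=2$ and $\beta=(c\alpha/2)^2$ if $j\ge3$, then replace $\alpha$ by $1/(d-\beta/\alpha)$ (with the old $\alpha$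 on the right) and $\mathbf p$ by $\mathbf z+\beta\mathbf p$; then replace $\mathbf x$ by $\mathbf x+\alpha\mathbf p$ and set $\mathbf r=\mathbf b-A\mathbf x$. The final $\mathbf x$ is $\mathtt{precondCheby}(A,\mathbf b,t,f,\lambda_{\min},\lambda_{\max})$. *Recursive solver.* Let $k\ge1$, let $A_0,\dots,A_\ell$ and $B_1,\dots,B_\ell$ be real square matrices with $\dim B_i=\dim A_{i-1}$, and for each $1\le i\le\ell$ let $$B_i=P_iL_i\begin{pmatrix}I&0\\0&A_i\end{pmatrix}L_i^{T}P_i^{T},\qquad L_i=\begin{pmatrix}L_{i}^{11}&0\\L_{i}^{21}&I\end{pmatrix},$$ with $P_i$ a permutation matrix and $L_i$ lower triangular and non-singular. Let $\Pi_i$ be the orthogonal projection onto the range of $B_i$. Put $\lambda_{\min}=1-2e^{-2}$, $\lambda_{\max}=(1+2e^{-2})k$, $t=\lceil1.33\sqrt k\,\rceil$. For $i=\ell,\ell-1,\dots,1$ define $\mathtt{Solve}_{B_i}(\mathbf b)$ as follows: let $\mathbf s=L_i^{-1}P_i^{-1}\Pi_i\mathbf b=\binom{\mathbf s_0}{\mathbf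 s_1}$ with $\mathbf s_1$ of length $\dim A_i$; let $\mathbf y_0=\mathbf s_0$, and let $\mathbf y_1=A_\ell^{+}\mathbf s_1$ if $i=\ell$, and $\mathbf y_1=\mathtt{precondCheby}(A_i,\mathbf s_1,t,\mathtt{Solve}_{B_{i+1}},\lambda_{\min},\lambda_{\max})$ if $i<\ell$; the result is $\Pi_iP_i^{-T}L_i^{-T}\binom{\mathbf y_0}{\mathbf y_1}$. **Lemma (correctness of $\mathtt{Solve}_{B_i}$).** If $A_0$ is an irreducible $\mathrm{SDDM}_0$-matrix and $B_i\preccurlyeq A_{i-1}\preccurlyeq kB_i$ for all $1\le i\le\ell$, then for every $1\le i\le\ell$: (a) $\mathtt{Solve}_{B_i}$ is a symmetric linear operator; (b) $\mathbf b\mapsto\mathtt{precondCheby}(A_{i-1},\mathbf b,t,\mathtt{Solve}_{B_i},\lambda_{\min},\lambda_{\max})$ is a symmetric linear operator; (c) $(1-2e^{-2})Z_i^{+}\preccurlyeq A_i\preccurlyeq(1+2e^{-2})Z_i^{+}$, where $Z_\ell=A_\ell^{+}$ and, for $i<\ell$, $Z_i$ is the matrix with $Z_i\mathbf s_1=\mathtt{precondCheby}(A_i,\mathbf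 s_1,t,\mathtt{Solve}_{B_{i+1}},\lambda_{\min},\lambda_{\max})$ for all $\mathbf s_1$; (d) $(1-2e^{-2})\,\mathtt{Solve}_{B_i}^{+}\preccurlyeq B_i\preccurlyeq(1+2e^{-2})\,\mathtt{Solve}_{B_i}^{+}$. -/

import Mathlib

open scoped Matrix

noncomputable section

namespace RecSolver

/-- `A ≼ B`: the matrix `B - A` is (symmetric and) positive semidefinite. -/
def Loewner {n : ℕ} (A B : Matrix (Fin n) (Fin n) ℝ) : Prop := (B - A).PosSemidef

infix:50 " ≼ " => Loewner

/-- `SDDM₀`-matrices: symmetric, weakly diagonally dominant, with non-positive off-diagonal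
entries. -/
structure IsSDDM0 {n : ℕ} (A : Matrix (Fin n) (Fin n) ℝ) : Prop where
  symm : A.IsSymm
  dominant : ∀ i, ∑ j ∈ Finset.univ.erase i, |A i j| ≤ A i i
  offDiag_nonpos : ∀ i j, i ≠ j → A i j ≤ 0

/-- A matrix is reducible if, after a simultaneous permutation of its rows and columns, it is
block diagonal with at least two blocks: `s` is the set of indices of one of the two groups of
blocks. -/
def IsReducible {n : ℕ} (A : Matrix (Fin n) (Fin n) ℝ) : Prop :=
  ∃ s : Set (Fin n), s.Nonempty ∧ sᶜ.Nonempty ∧ ∀ i ∈ s, ∀ j ∈ sᶜ, A i j = 0 ∧ A j i = 0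

/-- The four Moore–Penrose axioms: `X` is the pseudo-inverse of `A`. -/
structure IsMoorePenrose {n : ℕ} (A X : Matrix (Fin n) (Fin n) ℝ) : Prop where
  mul_mul_left : A * X * A = A
  mul_mul_right : X * A * X = X
  symm_left : (A * X)ᵀ = A * X
  symm_right : (X * A)ᵀ = X * A

theorem IsMoorePenrose.unique {n : ℕ} {A X Y : Matrix (Fin n) (Fin n) ℝ}
    (hX : IsMoorePenrose A X) (hY : IsMoorePenrose A Y) : X = Y := by
  have h1 : A * X = A * Y := by
    calc A * X = (A * X)ᵀ := hX.symm_left.symm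
      _ = ((A * Y) * (A * X))ᵀ := by
          rw [← Matrix.mul_assoc (A * Y), hY.mul_mul_left]
      _ = (A * X) * (A * Y) := by rw [Matrix.transpose_mul, hX.symm_left, hY.symm_left]
      _ = A * Y := by rw [← Matrix.mul_assoc, hX.mul_mul_left]
  have h2 : X * A = Y * A := by
    calc X * A = (X * A)ᵀ := hX.symm_right.symm
      _ = ((X * A) * (Y * A))ᵀ := by
          rw [Matrix.mul_assoc X, ← Matrix.mul_assoc A, hY.mul_mul_left]
      _ = (Y * A) * (X * A) := by rw [Matrix.transpose_mul, hX.symm_right, hY.symm_right]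
      _ = Y * A := by rw [Matrix.mul_assoc Y, ← Matrix.mul_assoc A, hX.mul_mul_left]
  calc X = X * A * X := hX.mul_mul_right.symm
    _ = Y * (A * X) := by rw [h2, Matrix.mul_assoc]
    _ = Y * A * Y := by rw [h1, Matrix.mul_assoc]
    _ = Y := hY.mul_mul_right

theorem exists_isMoorePenrose_of_isSymm {n : ℕ} {S : Matrix (Fin n) (Fin n) ℝ} (hS : S.IsSymm) :
    ∃ X, IsMoorePenrose S X ∧ X.IsSymm := by
  have hH : S.IsHermitian := by
    rw [Matrix.IsHermitian, Matrix.conjTranspose_eq_transpose_of_trivial]; exact hS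
  obtain ⟨U, D, hU, hE⟩ : ∃ (U : Matrix (Fin n) (Fin n) ℝ) (D : Fin n → ℝ),
      Uᵀ * U = 1 ∧ S = U * Matrix.diagonal D * Uᵀ := by
    refine ⟨hH.eigenvectorUnitary, hH.eigenvalues, ?_, ?_⟩
    · have := Unitary.coe_star_mul_self hH.eigenvectorUnitary
      rwa [Matrix.star_eq_conjTranspose, Matrix.conjTranspose_eq_transpose_of_trivial] at this
    · have := hH.spectral_theorem
      rw [Unitary.conjStarAlgAut_apply, Matrix.star_eq_conjTranspose,
        Matrix.conjTranspose_eq_transpose_of_trivial] at this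
      exact this
  have key : ∀ a b : Fin n → ℝ, (U * Matrix.diagonal a * Uᵀ) * (U * Matrix.diagonal b * Uᵀ) =
      U * Matrix.diagonal (fun i => a i * b i) * Uᵀ := by
    intro a b
    calc (U * Matrix.diagonal a * Uᵀ) * (U * Matrix.diagonal b * Uᵀ)
        = U * Matrix.diagonal a * (Uᵀ * U) * Matrix.diagonal b * Uᵀ := by
          simp only [Matrix.mul_assoc]
      _ = _ := by rw [hU, Matrix.mul_one, Matrix.mul_assoc U, Matrix.diagonal_mul_diagonal]
  have sym : ∀ a : Fin n → ℝ, (U * Matrix.diagonal a * Uᵀ)ᵀ = U * Matrix.diagonal a * Uᵀ := by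
    intro a
    simp [Matrix.transpose_mul, Matrix.mul_assoc]
  refine ⟨U * Matrix.diagonal (fun i => (D i)⁻¹) * Uᵀ, ⟨?_, ?_, ?_, ?_⟩, sym _⟩
  · rw [hE, key, key]; congr; funext i; by_cases h : D i = 0 <;> simp [h]
  · rw [hE, key, key]; congr; funext i; by_cases h : D i = 0 <;> simp [h]
  · rw [hE, key, sym]
  · rw [hE, key, sym]

theorem exists_isMoorePenrose {n : ℕ} (A : Matrix (Fin n) (Fin n) ℝ) :
    ∃ X, IsMoorePenrose A X := by
  obtain ⟨Y, hY, hs⟩ := exists_isMoorePenrose_of_isSymm (Matrix.isSymm_transpose_mul_self A)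
  have hz : A * (1 - Y * (Aᵀ * A)) = 0 := by
    have h0 : Aᵀ * A * (1 - Y * (Aᵀ * A)) = 0 := by
      rw [Matrix.mul_sub, Matrix.mul_one, ← Matrix.mul_assoc (Aᵀ * A), hY.mul_mul_left, sub_self]
    rw [← Matrix.conjTranspose_eq_transpose_of_trivial] at h0 ⊢
    exact (Matrix.conjTranspose_mul_self_mul_eq_zero A _).1 h0
  rw [Matrix.mul_sub, Matrix.mul_one, sub_eq_zero] at hz
  refine ⟨Y * Aᵀ, ⟨?_, ?_, ?_, ?_⟩⟩
  · rw [Matrix.mul_assoc, Matrix.mul_assoc Y]; exact hz.symm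
  · rw [Matrix.mul_assoc Y, ← Matrix.mul_assoc (Y * (Aᵀ * A)), hY.mul_mul_right]
  · rw [Matrix.transpose_mul, Matrix.transpose_mul, Matrix.transpose_transpose, hs.eq,
      Matrix.mul_assoc]
  · rw [Matrix.mul_assoc Y]; exact hY.symm_right

/-- The Moore–Penrose pseudo-inverse of a square real matrix. -/
def pinv {n : ℕ} (A : Matrix (Fin n) (Fin n) ℝ) : Matrix (Fin n) (Fin n) ℝ :=
  (exists_isMoorePenrose A).choose

theorem isMoorePenrose_pinv {n : ℕ} (A : Matrix (Fin n) (Fin n) ℝ) : IsMoorePenrose A (pinv A) :=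
  (exists_isMoorePenrose A).choose_spec

/-- The orthogonal projection `Π` of `ℝⁿ` onto the span (the range) of `B`. -/
def spanProj {n : ℕ} (B : Matrix (Fin n) (Fin n) ℝ) (b : Fin n → ℝ) : Fin n → ℝ :=
  WithLp.ofLp
    ((LinearMap.range (Matrix.toEuclideanLin B)).starProjection (WithLp.toLp 2 b))

/-- A function on `ℝⁿ` is a symmetric linear operator: it is realized by a symmetric matrix. -/
def IsSymmLinearOp {n : ℕ} (f : (Fin n → ℝ) → (Fin n → ℝ)) : Prop :=
  ∃ M : Matrix (Fin n) (Fin n) ℝ, M.IsSymm ∧ ∀ b, f b = M *ᵥ b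

/-- The variables of the preconditioned Chebyshev iteration. -/
structure ChebyState (n : ℕ) where
  x : Fin n → ℝ
  r : Fin n → ℝ
  p : Fin n → ℝ
  α : ℝ

/-- The state after `i` rounds of the preconditioned Chebyshev iteration for `A x = b`, where
`f` applies the preconditioner, `d` is the centre and `c` the half-length of the interval
`[d - c, d + c]` that is to contain the spectrum. -/
def chebyState {n : ℕ} (A : Matrix (Fin n) (Fin n) ℝ) (b : Fin n → ℝ)
    (f : (Fin n → ℝ) → (Fin n → ℝ)) (d c : ℝ) : ℕ → ChebyState n
  | 0 => ⟨0, b, 0, 0⟩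
  | i + 1 =>
    let s := chebyState A b f d c i
    let z := f s.r
    let β : ℝ := if i = 0 then 0 else if i = 1 then (c * s.α) ^ 2 / 2 else (c * s.α / 2) ^ 2
    let α : ℝ := if i = 0 then 1 / d else 1 / (d - β / s.α)
    let p := if i = 0 then z else z + β • s.p
    let x := s.x + α • p
    ⟨x, b - A *ᵥ x, p, α⟩

/-- The output of `t` rounds of the preconditioned Chebyshev method, started at `0`, for
`A x = b` with preconditioner `f` and spectral bounds `lmin`, `lmax`. -/
def precondCheby {n : ℕ} (A : Matrix (Fin n) (Fin n) ℝ) (b : Fin n → ℝ) (t : ℕ)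
    (f : (Fin n → ℝ) → (Fin n → ℝ)) (lmin lmax : ℝ) : Fin n → ℝ :=
  (chebyState A b f ((lmax + lmin) / 2) ((lmax - lmin) / 2) t).x

/-- The permutation matrix of a bijection: it sends `y` to `y ∘ σ`, and its inverse is its
transpose. -/
def permMatrix {n m r : ℕ} (σ : Fin n ≃ Fin m ⊕ Fin r) : Matrix (Fin n) (Fin m ⊕ Fin r) ℝ :=
  Matrix.of fun i s => if σ i = s then 1 else 0

/-- The matrix `[L₁₁, 0; L₂₁, I]`. -/
def lowerMatrix {m r : ℕ} (L₁₁ : Matrix (Fin m) (Fin m) ℝ) (L₂₁ : Matrix (Fin r) (Fin m) ℝ) :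
    Matrix (Fin m ⊕ Fin r) (Fin m ⊕ Fin r) ℝ :=
  Matrix.fromBlocks L₁₁ 0 L₂₁ 1

/-- The matrix `[I, 0; 0, A₁]`. -/
def coreMatrix (m : ℕ) {r : ℕ} (A₁ : Matrix (Fin r) (Fin r) ℝ) :
    Matrix (Fin m ⊕ Fin r) (Fin m ⊕ Fin r) ℝ :=
  Matrix.fromBlocks 1 0 0 A₁

/-- A partial Cholesky factorization `B = P L C Lᵀ Pᵀ`, with `L = [L₁₁, 0; L₂₁, I]` lower
triangular and non-singular, `C = [I, 0; 0, A₁]` and `P` a permutation matrix. Here `m` is the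
number of eliminated rows, and the permutation is given as a bijection between the indices of `B`
and the indices of the two blocks, in this order. -/
structure PartialChol {n r : ℕ} (B : Matrix (Fin n) (Fin n) ℝ)
    (A₁ : Matrix (Fin r) (Fin r) ℝ) where
  m : ℕ
  perm : Fin n ≃ Fin m ⊕ Fin r
  L₁₁ : Matrix (Fin m) (Fin m) ℝ
  L₂₁ : Matrix (Fin r) (Fin m) ℝ
  lower : ∀ a b, a < b → L₁₁ a b = 0
  diag_ne_zero : ∀ a, L₁₁ a a ≠ 0
  factor : B = permMatrix perm * lowerMatrix L₁₁ L₂₁ * coreMatrix m A₁ *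
    (lowerMatrix L₁₁ L₂₁)ᵀ * (permMatrix perm)ᵀ

namespace PartialChol

variable {n r : ℕ} {B : Matrix (Fin n) (Fin n) ℝ} {A₁ : Matrix (Fin r) (Fin r) ℝ}

/-- The permutation matrix `P`; its inverse is `Pᵀ`. -/
def P (F : PartialChol B A₁) : Matrix (Fin n) (Fin F.m ⊕ Fin r) ℝ := permMatrix F.perm

/-- The lower triangular factor `L`. -/
def L (F : PartialChol B A₁) : Matrix (Fin F.m ⊕ Fin r) (Fin F.m ⊕ Fin r) ℝ :=
  lowerMatrix F.L₁₁ F.L₂₁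

/-- Solving a system in `B` through its partial Cholesky factorization, where `inner` is the
solver used for the remaining system in `A₁`: with `s = L⁻¹ P⁻¹ Π b = (s₀, s₁)`, the result is
`Π P⁻ᵀ L⁻ᵀ (s₀, inner s₁)`. -/
def solveWith (F : PartialChol B A₁) (inner : (Fin r → ℝ) → (Fin r → ℝ)) (b : Fin n → ℝ) :
    Fin n → ℝ :=
  let s := F.L⁻¹ *ᵥ (F.Pᵀ *ᵥ spanProj B b)
  let y := Sum.elim (fun a => s (Sum.inl a)) (inner fun a => s (Sum.inr a))
  spanProj B (F.P *ᵥ ((F.L⁻¹)ᵀ *ᵥ y))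

end PartialChol

/-- A sequence of preconditioners and partial Cholesky factors with `ℓ` levels: `A i` is `A_i`
for `0 ≤ i ≤ ℓ`, and `B i` is the preconditioner `B_{i+1}` of `A_i` for `0 ≤ i < ℓ`, whose
partial Cholesky factorization leaves `A_{i+1}`. Values at larger indices play no role. -/
structure PrecondSeq (ℓ : ℕ) where
  dim : ℕ → ℕ
  A : (i : ℕ) → Matrix (Fin (dim i)) (Fin (dim i)) ℝ
  B : (i : ℕ) → Matrix (Fin (dim i)) (Fin (dim i)) ℝ
  chol : (i : ℕ) → i < ℓ → PartialChol (B i) (A (i + 1))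

/-- The lower spectral bound `1 - 2e⁻²` used in the recursive solver. -/
def lamMin : ℝ := 1 - 2 * Real.exp (-2)

/-- The upper spectral bound `(1 + 2e⁻²) k` used in the recursive solver. -/
def lamMax (k : ℝ) : ℝ := (1 + 2 * Real.exp (-2)) * k

/-- The number `⌈1.33 √k⌉` of Chebyshev rounds used in the recursive solver. -/
def rounds (k : ℝ) : ℕ := ⌈(1.33 : ℝ) * √k⌉₊

/-- The recursive solver: `S.solve k i _` is `Solve_{B_{i+1}}`. The remaining system in `A_{i+1}`
is handled by the pseudo-inverse at the last level, and by the preconditioned Chebyshev method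
with the next solver as preconditioner at all other levels. -/
def PrecondSeq.solve {ℓ : ℕ} (S : PrecondSeq ℓ) (k : ℝ) (i : ℕ) (hi : i < ℓ) :
    (Fin (S.dim i) → ℝ) → (Fin (S.dim i) → ℝ) :=
  (S.chol i hi).solveWith fun s₁ =>
    if h : i + 1 < ℓ then
      precondCheby (S.A (i + 1)) s₁ (rounds k) (S.solve k (i + 1) h) lamMin (lamMax k)
    else pinv (S.A (i + 1)) *ᵥ s₁
termination_by ℓ - i

end RecSolver

end

open RecSolver

/-! The accuracy statements involve pseudo-inverses, which behave badly under products. The proof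
works instead with `IsApproxInv lo hi Z A`: equal kernels and `lo Z ≼ ZAZ ≼ hi Z`. This contains no
inverse, survives congruences, and turns into `lo Z⁺ ≼ A ≼ hi Z⁺` after conjugation by `Z⁺`
(`IsApproxInv.loewner_pinv`).

Write `ε = 2e⁻²`. Descending in the level, an `(1 - ε, 1 + ε)`-inverse is passed along three moves.
An approximate inverse of `A_i` gives one of `B_i` with the same constants, because the
factorization is a congruence and the identity block is inverted exactly
(`PartialChol.exists_solveWith`). The sandwich `B_i ≼ A_{i-1} ≼ k B_i` costs a factor `k` in the
upper constant, which yields exactly `lamMin` and `lamMax k` (`IsApproxInv.of_sandwich`). Chebyshev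
iteration brings the constants back to `1 ± ε` (`IsApproxInv.exists_precondCheby`).

For the last move, write `M = W Wᵀ` with `Wᵀ A W` diagonal. The iteration splits into scalar ones,
and on an eigenvalue `λ` the residual is `T_t((d - λ)/c) / T_t(d/c)` (`scalarCheby_residual`). The
numerator is at most `1` in absolute value on the spectral interval, and `t = ⌈1.33 √k⌉` makes the
denominator at least `e²/2` (`scalarCheby_accuracy`). The output is therefore a symmetric matrix `W
diag(q) Wᵀ` with `|1 - λ q| ≤ ε` on each nonzero column of `W`. -/

namespace RecSolver

/-! ### Approximate inverses and the Loewner order -/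

section Matrices

variable {ι κ : Type*} [Fintype ι] [Fintype κ]

theorem PosSemidef.transpose_eq {ι : Type*} {A : Matrix ι ι ℝ} (hA : A.PosSemidef) : Aᵀ = A := by
  rw [← Matrix.conjTranspose_eq_transpose_of_trivial]
  exact hA.isHermitian

theorem PosSemidef.congr_transpose {A : Matrix ι ι ℝ} (hA : A.PosSemidef) (T : Matrix κ ι ℝ) :
    (T * A * Tᵀ).PosSemidef := by
  rw [← Matrix.conjTranspose_eq_transpose_of_trivial]
  exact hA.mul_mul_conjTranspose_same T

theorem PosSemidef.mulVec_eq_zero_of_dotProduct {A : Matrix ι ι ℝ} (hA : A.PosSemidef)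
    {v : ι → ℝ} (hv : v ⬝ᵥ A *ᵥ v = 0) : A *ᵥ v = 0 :=
  (hA.dotProduct_mulVec_zero_iff v).1 (by simpa using hv)

theorem PosSemidef.dotProduct_nonneg {A : Matrix ι ι ℝ} (hA : A.PosSemidef) (v : ι → ℝ) :
    0 ≤ v ⬝ᵥ A *ᵥ v := by
  simpa using hA.dotProduct_mulVec_nonneg v

theorem mul_eq_zero_of_ker_le {κ : Type*} {Z A : Matrix ι ι ℝ} (h : ∀ v, Z *ᵥ v = 0 → A *ᵥ v = 0)
    {X : Matrix ι κ ℝ} (hX : Z * X = 0) : A * X = 0 := by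
  ext i j
  have := h (X.col j) (by
    ext a
    simpa [Matrix.mul_apply, Matrix.mulVec, dotProduct] using congrFun (congrFun hX a) j)
  simpa [Matrix.mul_apply, Matrix.mulVec, dotProduct] using congrFun this i

/-- `Z` is an approximate (pseudo-)inverse of `A`: the two have the same kernel and
`lo Z ≼ Z A Z ≼ hi Z`. -/
structure IsApproxInv (lo hi : ℝ) (Z A : Matrix ι ι ℝ) : Prop where
  posSemidef : Z.PosSemidef
  ker_iff : ∀ v, Z *ᵥ v = 0 ↔ A *ᵥ v = 0
  lower : (Z * A * Z - lo • Z).PosSemidef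
  upper : (hi • Z - Z * A * Z).PosSemidef

/-- An approximate inverse of `B` is one of `A` with weaker constants if `B ≼ A ≼ k B`. -/
theorem IsApproxInv.of_sandwich {lo hi k : ℝ} {M A B : Matrix ι ι ℝ}
    (h : IsApproxInv lo hi M B) (hk : 1 ≤ k) (hBpos : B.PosSemidef) (hApos : A.PosSemidef)
    (hBA : (A - B).PosSemidef) (hAB : (k • B - A).PosSemidef) :
    IsApproxInv lo (hi * k) M A := by
  have hM := PosSemidef.transpose_eq h.posSemidef
  refine ⟨h.posSemidef, fun v => (h.ker_iff v).trans ⟨fun hv => ?_, fun hv => ?_⟩, ?_, ?_⟩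
  · refine PosSemidef.mulVec_eq_zero_of_dotProduct hApos (le_antisymm ?_
      (PosSemidef.dotProduct_nonneg hApos v))
    have := PosSemidef.dotProduct_nonneg hAB v
    simp only [Matrix.sub_mulVec, Matrix.smul_mulVec, hv, smul_zero, zero_sub, dotProduct_neg] at this
    linarith
  · refine PosSemidef.mulVec_eq_zero_of_dotProduct hBpos (le_antisymm ?_
      (PosSemidef.dotProduct_nonneg hBpos v))
    have := PosSemidef.dotProduct_nonneg hBA v
    simp only [Matrix.sub_mulVec, hv, zero_sub, dotProduct_neg] at this
    linarith
  · have h2 := PosSemidef.congr_transpose hBA M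
    rw [hM] at h2
    convert h.lower.add h2 using 1
    simp only [Matrix.mul_sub, Matrix.sub_mul]
    abel
  · have h2 := PosSemidef.congr_transpose hAB M
    rw [hM] at h2
    -- Decomposition `hi k M - MAM = k (hi M - MBM) + M (kB - A) M`.
    convert (h.upper.smul (zero_le_one.trans hk)).add h2 using 1
    simp only [Matrix.mul_sub, Matrix.sub_mul, smul_sub, Matrix.mul_smul, Matrix.smul_mul, smul_smul,
      mul_comm hi k]
    abel

end Matrices

/-! ### Pseudo-inverses and range projections -/

section PseudoInverse

variable {n : ℕ}

theorem isSymm_pinv {Z : Matrix (Fin n) (Fin n) ℝ} (hZ : Z.IsSymm) : (pinv Z)ᵀ = pinv Z := by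
  obtain ⟨X, hX, hs⟩ := exists_isMoorePenrose_of_isSymm hZ
  rw [(isMoorePenrose_pinv Z).unique hX, hs.eq]

/-- Conjugating both bounds by `Z⁺` sends `Z` to `Z⁺ Z Z⁺ = Z⁺` and `ZAZ` to `A`. The latter holds
because `A` vanishes on the kernel of `Z`, so that the projection `Z⁺ Z` is absorbed on either side
of `A`. -/
theorem IsApproxInv.loewner_pinv {lo hi : ℝ} {Z A : Matrix (Fin n) (Fin n) ℝ}
    (h : IsApproxInv lo hi Z A) (hA : A.IsSymm) : lo • pinv Z ≼ A ∧ A ≼ hi • pinv Z := by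
  have hZ : Z.IsSymm := PosSemidef.transpose_eq h.posSemidef
  have hp := isMoorePenrose_pinv Z
  have hs := isSymm_pinv hZ
  have hAP : A * (pinv Z * Z) = A := by
    have h0 : A * (1 - pinv Z * Z) = 0 :=
      mul_eq_zero_of_ker_le (fun v hv => (h.ker_iff v).1 hv) (by
        rw [Matrix.mul_sub, Matrix.mul_one, ← Matrix.mul_assoc, hp.mul_mul_left, sub_self])
    rw [Matrix.mul_sub, Matrix.mul_one, sub_eq_zero] at h0
    exact h0.symm
  have hcomm : pinv Z * Z = Z * pinv Z := by
    rw [← hp.symm_right, Matrix.transpose_mul, hs, hZ.eq]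
  have hPA : pinv Z * Z * A = A := by
    have := congrArg Matrix.transpose hAP
    rwa [Matrix.transpose_mul, hp.symm_right, hA.eq] at this
  have hmid : pinv Z * (Z * A * Z) * pinv Z = A := by
    calc pinv Z * (Z * A * Z) * pinv Z = (pinv Z * Z * A) * (Z * pinv Z) := by
          simp only [Matrix.mul_assoc]
      _ = A := by rw [hPA, ← hcomm, hAP]
  constructor
  · have := PosSemidef.congr_transpose h.lower (pinv Z)
    rw [hs, Matrix.mul_sub, Matrix.sub_mul, hmid, Matrix.mul_smul, Matrix.smul_mul,
      hp.mul_mul_right] at this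
    exact this
  · have := PosSemidef.congr_transpose h.upper (pinv Z)
    rw [hs, Matrix.mul_sub, Matrix.sub_mul, hmid, Matrix.mul_smul, Matrix.smul_mul,
      hp.mul_mul_right] at this
    exact this

/-- Base case of the recursion: the exact inverse satisfies `A⁺ A A⁺ = A⁺`, so any constants on the
two sides of `1` will do. -/
theorem isApproxInv_pinv {lo hi : ℝ} (hlo : lo ≤ 1) (hhi : 1 ≤ hi)
    {A : Matrix (Fin n) (Fin n) ℝ} (hA : A.PosSemidef) : IsApproxInv lo hi (pinv A) A := by
  have hAs : A.IsSymm := PosSemidef.transpose_eq hA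
  have hp := isMoorePenrose_pinv A
  have hs := isSymm_pinv hAs
  have hpos : (pinv A).PosSemidef := by
    have := PosSemidef.congr_transpose hA (pinv A)
    rwa [hs, hp.mul_mul_right] at this
  have hcomm : pinv A * A = A * pinv A := by
    rw [← hp.symm_right, Matrix.transpose_mul, hs, hAs.eq]
  refine ⟨hpos, fun v => ⟨fun hv => ?_, fun hv => ?_⟩, ?_, ?_⟩
  · rw [← hp.mul_mul_left, Matrix.mul_assoc, hcomm, ← Matrix.mulVec_mulVec, ← Matrix.mulVec_mulVec,
      hv, Matrix.mulVec_zero, Matrix.mulVec_zero]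
  · rw [← hp.mul_mul_right, Matrix.mul_assoc, ← hcomm, ← Matrix.mulVec_mulVec,
      ← Matrix.mulVec_mulVec, hv, Matrix.mulVec_zero, Matrix.mulVec_zero]
  · rw [hp.mul_mul_right]
    convert hpos.smul (sub_nonneg.2 hlo) using 1
    rw [sub_smul, one_smul]
  · rw [hp.mul_mul_right]
    convert hpos.smul (sub_nonneg.2 hhi) using 1
    rw [sub_smul, one_smul]

/-- `B B⁺ b` lies in the range of `B`, and `Bᵀ B B⁺ = Bᵀ` makes `b - B B⁺ b` orthogonal to that
range. Symmetry of `B` is not needed. -/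
theorem spanProj_eq_mulVec (B : Matrix (Fin n) (Fin n) ℝ) (b : Fin n → ℝ) :
    spanProj B b = (B * pinv B) *ᵥ b := by
  have hp := isMoorePenrose_pinv B
  have key : (LinearMap.range (Matrix.toEuclideanLin B)).starProjection (WithLp.toLp 2 b) =
      WithLp.toLp 2 ((B * pinv B) *ᵥ b) := by
    apply Submodule.eq_starProjection_of_mem_of_inner_eq_zero
    · exact ⟨WithLp.toLp 2 (pinv B *ᵥ b), by simp [Matrix.toLpLin_apply]⟩
    · rintro _ ⟨w, rfl⟩
      have h0 : (b - (B * pinv B) *ᵥ b) ⬝ᵥ B *ᵥ w.ofLp = 0 := by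
        rw [Matrix.dotProduct_mulVec, ← Matrix.mulVec_transpose, Matrix.mulVec_sub,
          Matrix.mulVec_mulVec]
        have : Bᵀ * (B * pinv B) = Bᵀ := by
          conv_lhs => rw [← hp.symm_left, ← Matrix.transpose_mul, hp.mul_mul_left]
        rw [this, sub_self, zero_dotProduct]
      rw [dotProduct_comm] at h0
      simpa [EuclideanSpace.inner_eq_star_dotProduct, Matrix.toLpLin_apply] using h0
  rw [spanProj, key]

end PseudoInverse

/-- Gershgorin: each eigenvalue is within `∑ |A j h|` (over `h ≠ j`) of some `A j j`, and diagonal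
dominance keeps that disc in the nonnegative half-line. -/
theorem IsSDDM0.posSemidef {n : ℕ} {A : Matrix (Fin n) (Fin n) ℝ} (hA : IsSDDM0 A) :
    A.PosSemidef := by
  have hH : A.IsHermitian := by
    rw [Matrix.IsHermitian, Matrix.conjTranspose_eq_transpose_of_trivial]; exact hA.symm
  rw [hH.posSemidef_iff_eigenvalues_nonneg]
  intro i
  have hev : Module.End.HasEigenvalue (Matrix.toLin' A) (hH.eigenvalues i) := by
    refine Module.End.hasEigenvalue_of_hasEigenvector
      (x := (hH.eigenvectorBasis i).ofLp) ⟨?_, ?_⟩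
    · rw [Module.End.mem_eigenspace_iff, Matrix.toLin'_apply]
      exact hH.mulVec_eigenvectorBasis i
    · intro h0
      exact hH.eigenvectorBasis.toBasis.ne_zero i (by
        rw [OrthonormalBasis.coe_toBasis]
        exact WithLp.ofLp_injective 2 h0)
  obtain ⟨j, hj⟩ := eigenvalue_mem_ball hev
  rw [Metric.mem_closedBall, Real.dist_eq] at hj
  have h1 := hA.dominant j
  have h2 := (abs_le.1 hj).1
  simp only [Real.norm_eq_abs] at h2
  simp only [Pi.zero_apply]
  linarith

/-! ### The scalar iteration and Chebyshev polynomials -/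

section ScalarChebyshev

open Polynomial.Chebyshev

theorem chebyState_succ_x {n : ℕ} (A : Matrix (Fin n) (Fin n) ℝ) (b : Fin n → ℝ)
    (f : (Fin n → ℝ) → (Fin n → ℝ)) (d c : ℝ) (j : ℕ) :
    (chebyState A b f d c (j + 1)).x = (chebyState A b f d c j).x +
      (chebyState A b f d c (j + 1)).α • (chebyState A b f d c (j + 1)).p := by
  rw [chebyState]

/-- The Chebyshev iteration for the scalar equation `lam * x = 1`. -/
noncomputable def scalarCheby (d c lam : ℝ) (j : ℕ) : ChebyState 1 :=
  chebyState (Matrix.of fun _ _ => lam) (fun _ => 1) id d c j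

theorem scalarCheby_r (d c lam : ℝ) (j : ℕ) :
    (scalarCheby d c lam j).r 0 = 1 - lam * (scalarCheby d c lam j).x 0 := by
  cases j <;> simp [scalarCheby, chebyState, Matrix.mulVec, dotProduct]

theorem scalarCheby_step {d c lam : ℝ} {j : ℕ} {α β : ℝ}
    (hβ : β = if j = 0 then (c * (scalarCheby d c lam (j + 1)).α) ^ 2 / 2
      else (c * (scalarCheby d c lam (j + 1)).α / 2) ^ 2)
    (hα : α = 1 / (d - β / (scalarCheby d c lam (j + 1)).α)) :
    (scalarCheby d c lam (j + 2)).α = α ∧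
    (scalarCheby d c lam (j + 2)).p 0 =
      (scalarCheby d c lam (j + 1)).r 0 + β * (scalarCheby d c lam (j + 1)).p 0 ∧
    (scalarCheby d c lam (j + 2)).x 0 =
      (scalarCheby d c lam (j + 1)).x 0 + α * (scalarCheby d c lam (j + 2)).p 0 := by
  have key : (scalarCheby d c lam (j + 2)).α = α := by
    subst hα
    subst hβ
    unfold scalarCheby
    rw [chebyState]
    simp
  refine ⟨key, ?_, ?_⟩
  · subst hβ
    unfold scalarCheby
    rw [chebyState]
    by_cases hj : j = 0 <;> simp [hj]
  · rw [← key]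
    unfold scalarCheby
    rw [chebyState_succ_x]
    simp

/-- The residual of the scalar iteration is the quotient of Chebyshev polynomials
`T_j ((d - lam) / c) / T_j (d / c)`. -/
theorem scalarCheby_residual {d c : ℝ} (hc : 0 < c) (hcd : c < d) (lam : ℝ) (j : ℕ) :
    (1 - lam * (scalarCheby d c lam j).x 0) * (T ℝ (j : ℤ)).eval (d / c) =
      (T ℝ (j : ℤ)).eval ((d - lam) / c) := by
  have hd : 0 < d := hc.trans hcd
  have hθ : 1 ≤ d / c := by rw [le_div_iff₀ hc]; linarith
  set u : ℕ → ℝ := fun j => (T ℝ (j : ℤ)).eval (d / c) with hu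
  set v : ℕ → ℝ := fun j => (T ℝ (j : ℤ)).eval ((d - lam) / c) with hv
  have hupos : ∀ j, 0 < u j := fun j =>
    zero_lt_one.trans_le (one_le_eval_T_real _ hθ)
  have hu2 : ∀ j, u (j + 2) = 2 * (d / c) * u (j + 1) - u j := by
    intro j
    simp only [hu]
    push_cast
    rw [T_add_two]
    simp
  have hv2 : ∀ j, v (j + 2) = 2 * ((d - lam) / c) * v (j + 1) - v j := by
    intro j
    simp only [hv]
    push_cast
    rw [T_add_two]
    simp
  have hu0 : u 0 = 1 := by simp [hu]
  have hu1 : u 1 = d / c := by simp [hu]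
  have hv0 : v 0 = 1 := by simp [hv]
  have hv1 : v 1 = (d - lam) / c := by simp [hv]
  set r : ℕ → ℝ := fun j => 1 - lam * (scalarCheby d c lam j).x 0 with hr
  -- Besides the residual at two consecutive indices, the invariant carries a closed form of `α` and
  -- the last increment of `x` times `lam`; the latter eliminates `p` without dividing by `lam`. The
  -- factor `1` instead of `2` at `j = 0` reflects `T_1 = X`.
  have key : ∀ j, (scalarCheby d c lam (j + 1)).α = (if j = 0 then 1 else 2) / c * (u j / u (j + 1)) ∧
      r j * u j = v j ∧ r (j + 1) * u (j + 1) = v (j + 1) ∧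
      lam * ((scalarCheby d c lam (j + 1)).α * (scalarCheby d c lam (j + 1)).p 0) =
        r j - r (j + 1) := by
    intro j
    induction j with
    | zero =>
      have hα : (scalarCheby d c lam (0 + 1)).α = 1 / d := by simp [scalarCheby, chebyState]
      have hx : (scalarCheby d c lam (0 + 1)).x 0 = 1 / d := by simp [scalarCheby, chebyState]
      have hx0 : (scalarCheby d c lam 0).x 0 = 0 := by simp [scalarCheby, chebyState]
      have hp : (scalarCheby d c lam (0 + 1)).p 0 = 1 := by simp [scalarCheby, chebyState]
      simp only [hr, hα, hx, hx0, hp, zero_add, hu0, hu1, hv0, hv1]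
      refine ⟨?_, by ring, ?_, by ring⟩
      · simp; field_simp
      · field_simp
    | succ j ih =>
      obtain ⟨hα, h0, h1, h2⟩ := ih
      have huj := hupos j
      have huj1 := hupos (j + 1)
      have huj2 := hupos (j + 2)
      set a := (scalarCheby d c lam (j + 1)).α with ha
      set p := (scalarCheby d c lam (j + 1)).p 0 with hp
      have hapos : 0 < a := by
        rw [hα]
        split_ifs <;> positivity
      obtain ⟨β, hβ⟩ : ∃ β : ℝ, β = if j = 0 then (c * a) ^ 2 / 2 else (c * a / 2) ^ 2 := ⟨_, rfl⟩
      -- The special `β` of the second round compensates the missing factor `2` in the first `α`, so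
      -- both cases give one formula.
      have hβa : β = a * (c / 2 * (u j / u (j + 1))) := by
        rw [hβ]
        split_ifs with hj
        · rw [if_pos hj] at hα; rw [hα]; field_simp
        · rw [if_neg hj] at hα; rw [hα]; field_simp
      obtain ⟨e1, e2, e3⟩ := scalarCheby_step (d := d) (c := c) (lam := lam) (j := j) hβ rfl
      rw [← ha] at e1 e3
      have hg : β / a = c / 2 * (u j / u (j + 1)) := by rw [hβa]; field_simp
      -- This is the three-term recurrence for `u`, and the reason why `α` keeps its closed form.
      have hden : d - β / a = c * u (j + 2) / (2 * u (j + 1)) := by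
        rw [hg, hu2]; field_simp
      have hα' : 1 / (d - β / a) = 2 / c * (u (j + 1) / u (j + 2)) := by
        rw [hden]; field_simp
      rw [hα'] at e1 e3
      rw [scalarCheby_r] at e2
      have hrj : (1 - lam * (scalarCheby d c lam (j + 1)).x 0) = r (j + 1) := rfl
      rw [hrj, ← hp] at e2
      have hr2 : lam * (2 / c * (u (j + 1) / u (j + 2)) * (scalarCheby d c lam (j + 2)).p 0) =
          r (j + 1) - r (j + 2) := by
        simp only [hr, e3]; ring
      refine ⟨by rw [e1]; simp, h1, ?_, by rw [e1]; exact hr2⟩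
      rw [e2, hβa] at hr2
      have hr3 : r (j + 2) * u (j + 2) = r (j + 1) * u (j + 2) -
          (2 / c * u (j + 1) * lam * r (j + 1) + u j * (lam * (a * p))) := by
        have : r (j + 2) = r (j + 1) - lam * (2 / c * (u (j + 1) / u (j + 2)) *
          (r (j + 1) + a * (c / 2 * (u j / u (j + 1))) * p)) := by linarith
        rw [this]
        field_simp
      change r (j + 2) * u (j + 2) = v (j + 2)
      rw [hr3, h2, hv2, hu2, ← h1, ← h0]
      field_simp
      ring
  exact (key j).2.1

end ScalarChebyshev

/-! ### Decoupling the matrix iteration -/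

section DiagonalChebyshev

variable {n : ℕ}

theorem mulVec_diag_mulVec {ι κ : Type*} [Fintype ι] [DecidableEq ι] (W : Matrix κ ι ℝ)
    (g y : ι → ℝ) :
    W *ᵥ (fun i => g i * y i) = (W * Matrix.diagonal g) *ᵥ y := by
  rw [← Matrix.mulVec_mulVec]
  congr 1
  ext i
  rw [Matrix.mulVec_diagonal]

/-- If `M = W Wᵀ` and `Wᵀ A W` is diagonal, then the Chebyshev iteration for `A` preconditioned
by `M` decouples into scalar iterations. -/
theorem chebyState_of_diagonal {M A W : Matrix (Fin n) (Fin n) ℝ} {lam : Fin n → ℝ}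
    (hM : M = W * Wᵀ) (hA : Wᵀ * A * W = Matrix.diagonal lam) {f : (Fin n → ℝ) → (Fin n → ℝ)}
    (hf : ∀ b, f b = M *ᵥ b) (d c : ℝ) (b : Fin n → ℝ) (j : ℕ) :
    (chebyState A b f d c j).x =
      W *ᵥ (fun i => (scalarCheby d c (lam i) j).x 0 * (Wᵀ *ᵥ b) i) ∧
    (chebyState A b f d c j).p =
      W *ᵥ (fun i => (scalarCheby d c (lam i) j).p 0 * (Wᵀ *ᵥ b) i) ∧
    (chebyState A b f d c j).r = b - A *ᵥ (chebyState A b f d c j).x ∧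
    ∀ l, (scalarCheby d c l j).α = (chebyState A b f d c j).α := by
  induction j with
  | zero =>
    refine ⟨?_, ?_, ?_, ?_⟩ <;> simp [scalarCheby, chebyState, ← Pi.zero_def]
  | succ j ih =>
    obtain ⟨hx, hp, hr, hα⟩ := ih
    have hz : f (chebyState A b f d c j).r =
        W *ᵥ (fun i => (scalarCheby d c (lam i) j).r 0 * (Wᵀ *ᵥ b) i) := by
      rw [hf, hr, hx, hM, ← Matrix.mulVec_mulVec]
      congr 1
      rw [Matrix.mulVec_sub, Matrix.mulVec_mulVec, Matrix.mulVec_mulVec, hA]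
      ext i
      rw [Pi.sub_apply, Matrix.mulVec_diagonal, scalarCheby_r]
      ring
    have hpn : (chebyState A b f d c (j + 1)).p =
        W *ᵥ (fun i => (scalarCheby d c (lam i) (j + 1)).p 0 * (Wᵀ *ᵥ b) i) := by
      have e : ∀ l, (scalarCheby d c l (j + 1)).p 0 = if j = 0 then (scalarCheby d c l j).r 0 else
          (scalarCheby d c l j).r 0 + (if j = 0 then 0 else if j = 1 then
            (c * (chebyState A b f d c j).α) ^ 2 / 2 else
            (c * (chebyState A b f d c j).α / 2) ^ 2) * (scalarCheby d c l j).p 0 := by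
        intro l
        rw [← hα l]
        unfold scalarCheby
        rw [chebyState]
        split_ifs <;> simp
      simp only [e]
      rw [chebyState]
      simp only [hz, hp]
      split_ifs
      · rfl
      all_goals
        rw [← Matrix.mulVec_smul, ← Matrix.mulVec_add]
        congr 1
        ext i
        simp
        ring
    -- The coefficients depend on `d`, `c` and the round only, so all scalar iterations share them
    -- with the matrix iteration.
    have hαn : ∀ l, (scalarCheby d c l (j + 1)).α = (chebyState A b f d c (j + 1)).α := by
      intro l
      have := hα l
      unfold scalarCheby at this ⊢
      rw [chebyState, chebyState]
      simp only [this]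
    refine ⟨?_, hpn, by rw [chebyState], hαn⟩
    have e : ∀ l, (scalarCheby d c l (j + 1)).x 0 = (scalarCheby d c l j).x 0 +
        (chebyState A b f d c (j + 1)).α * (scalarCheby d c l (j + 1)).p 0 := by
      intro l
      rw [← hαn l]
      unfold scalarCheby
      rw [chebyState_succ_x]
      simp
    rw [chebyState_succ_x, hx, hpn, ← Matrix.mulVec_smul, ← Matrix.mulVec_add]
    congr 1
    ext i
    simp only [e, Pi.add_apply, Pi.smul_apply, smul_eq_mul]
    ring

end DiagonalChebyshev

/-! ### Simultaneous diagonalization -/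

section Diagonalization

variable {n : ℕ}

theorem exists_orthogonal_diagonalization {S : Matrix (Fin n) (Fin n) ℝ} (hS : Sᵀ = S) :
    ∃ (U : Matrix (Fin n) (Fin n) ℝ) (D : Fin n → ℝ),
      Uᵀ * U = 1 ∧ U * Uᵀ = 1 ∧ S = U * Matrix.diagonal D * Uᵀ := by
  have hH : S.IsHermitian := by
    rw [Matrix.IsHermitian, Matrix.conjTranspose_eq_transpose_of_trivial]; exact hS
  have h1 := Unitary.coe_star_mul_self hH.eigenvectorUnitary
  rw [Matrix.star_eq_conjTranspose, Matrix.conjTranspose_eq_transpose_of_trivial] at h1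
  refine ⟨hH.eigenvectorUnitary, hH.eigenvalues, h1, mul_eq_one_comm.1 h1, ?_⟩
  have := hH.spectral_theorem
  rw [Unitary.conjStarAlgAut_apply, Matrix.star_eq_conjTranspose,
    Matrix.conjTranspose_eq_transpose_of_trivial] at this
  exact this

theorem PosSemidef.exists_eq_mul_transpose {M : Matrix (Fin n) (Fin n) ℝ} (hM : M.PosSemidef) :
    ∃ R : Matrix (Fin n) (Fin n) ℝ, M = R * Rᵀ := by
  obtain ⟨U, D, h1, -, rfl⟩ := exists_orthogonal_diagonalization (PosSemidef.transpose_eq hM)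
  have hD : ∀ i, 0 ≤ D i := by
    have := PosSemidef.congr_transpose hM Uᵀ
    rw [Matrix.transpose_transpose] at this
    have e : Uᵀ * (U * Matrix.diagonal D * Uᵀ) * U = Matrix.diagonal D := by
      calc _ = (Uᵀ * U) * Matrix.diagonal D * (Uᵀ * U) := by simp only [Matrix.mul_assoc]
        _ = _ := by rw [h1, Matrix.one_mul, Matrix.mul_one]
    rw [e, Matrix.posSemidef_diagonal_iff] at this
    exact this
  refine ⟨U * Matrix.diagonal (fun i => √(D i)), ?_⟩
  have hsq : Matrix.diagonal D =
      Matrix.diagonal (fun i => √(D i)) * Matrix.diagonal (fun i => √(D i)) := by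
    rw [Matrix.diagonal_mul_diagonal]
    simp only [Real.mul_self_sqrt (hD _)]
  rw [Matrix.transpose_mul, Matrix.diagonal_transpose, hsq]
  simp only [Matrix.mul_assoc]

/-- Simultaneous diagonalization of `A` and of an approximate inverse `M` of it. -/
theorem IsApproxInv.exists_diagonal {lo hi : ℝ} {M A : Matrix (Fin n) (Fin n) ℝ}
    (h : IsApproxInv lo hi M A) (hA : A.PosSemidef) :
    ∃ (W : Matrix (Fin n) (Fin n) ℝ) (lam : Fin n → ℝ), M = W * Wᵀ ∧
      Wᵀ * A * W = Matrix.diagonal lam ∧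
      ∀ i, (∀ a, W a i = 0) ∨ (lo ≤ lam i ∧ lam i ≤ hi) := by
  obtain ⟨R, hR⟩ := PosSemidef.exists_eq_mul_transpose h.posSemidef
  have hAs := PosSemidef.transpose_eq hA
  obtain ⟨V, lam, hV1, hV2, hVd⟩ :=
    exists_orthogonal_diagonalization (S := Rᵀ * A * R) (by
      simp [Matrix.transpose_mul, Matrix.mul_assoc, hAs])
  obtain ⟨W, hWdef⟩ : ∃ W, W = R * V := ⟨_, rfl⟩
  have hM : M = W * Wᵀ := by
    rw [hWdef, Matrix.transpose_mul, Matrix.mul_assoc, ← Matrix.mul_assoc V, hV2, Matrix.one_mul, hR]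
  have hW : Wᵀ * A * W = Matrix.diagonal lam := by
    calc Wᵀ * A * W = Vᵀ * (Rᵀ * A * R) * V := by
          rw [hWdef, Matrix.transpose_mul]; simp only [Matrix.mul_assoc]
      _ = (Vᵀ * V) * Matrix.diagonal lam * (Vᵀ * V) := by
          rw [hVd]; simp only [Matrix.mul_assoc]
      _ = _ := by rw [hV1, Matrix.one_mul, Matrix.mul_one]
  refine ⟨W, lam, hM, hW, fun i => ?_⟩
  obtain ⟨w, hw⟩ : ∃ w, w = W *ᵥ Pi.single i 1 := ⟨_, rfl⟩
  have hwi : ∀ a, w a = W a i := fun a => by rw [hw]; simp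
  have hWAw : Wᵀ *ᵥ (A *ᵥ w) = lam i • Pi.single i 1 := by
    rw [hw, Matrix.mulVec_mulVec, Matrix.mulVec_mulVec, hW]
    ext a
    rw [Matrix.mulVec_diagonal]
    by_cases hai : a = i
    · subst hai; simp
    · simp [hai]
  have hwdot : ∀ y, w ⬝ᵥ y = (Wᵀ *ᵥ y) i := by
    intro y
    simp [dotProduct, Matrix.mulVec, hwi]
  have hwAw : w ⬝ᵥ A *ᵥ w = lam i := by rw [hwdot, hWAw]; simp
  have hMAw : M *ᵥ (A *ᵥ w) = lam i • w := by
    rw [hM, ← Matrix.mulVec_mulVec, hWAw, Matrix.mulVec_smul, hw]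
  by_cases hl : lam i = 0
  · left
    -- A column `w` of `W` with eigenvalue `0` is in the kernel of `A`, hence of `M = W Wᵀ`. Thus
    -- `Wᵀ w = 0`, whose `i`-th entry is `w ⬝ᵥ w`.
    have hAw : A *ᵥ w = 0 := PosSemidef.mulVec_eq_zero_of_dotProduct hA (hwAw.trans hl)
    have hMw : M *ᵥ w = 0 := (h.ker_iff w).2 hAw
    have h0 : (Wᵀ *ᵥ w) ⬝ᵥ (Wᵀ *ᵥ w) = 0 := by
      rw [Matrix.dotProduct_mulVec, Matrix.vecMul_transpose, Matrix.mulVec_mulVec, ← hM, hMw,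
        zero_dotProduct]
    have h1 : w ⬝ᵥ w = 0 := by rw [hwdot, dotProduct_self_eq_zero.1 h0]; rfl
    intro a
    rw [← hwi, dotProduct_self_eq_zero.1 h1]
    rfl
  · right
    -- A preimage of `w` under `M`, scaled so that `u ⬝ᵥ M u = 1` and `u ⬝ᵥ M A M u = lam i`.
    -- Testing the two Loewner bounds on it bounds `lam i`.
    obtain ⟨u, hu⟩ : ∃ u, u = (lam i)⁻¹ • (A *ᵥ w) := ⟨_, rfl⟩
    have hMu : M *ᵥ u = w := by
      rw [hu, Matrix.mulVec_smul, hMAw, smul_smul, inv_mul_cancel₀ hl, one_smul]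
    have huw : u ⬝ᵥ w = 1 := by
      rw [hu, smul_dotProduct, dotProduct_comm, hwAw, smul_eq_mul, inv_mul_cancel₀ hl]
    have huMAMu : u ⬝ᵥ (M * A * M) *ᵥ u = lam i := by
      rw [← Matrix.mulVec_mulVec, hMu, ← Matrix.mulVec_mulVec, hMAw, dotProduct_smul, huw,
        smul_eq_mul, mul_one]
    have h1 := PosSemidef.dotProduct_nonneg h.lower u
    have h2 := PosSemidef.dotProduct_nonneg h.upper u
    rw [Matrix.sub_mulVec, dotProduct_sub, huMAMu, Matrix.smul_mulVec, hMu, dotProduct_smul, huw,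
      smul_eq_mul, mul_one] at h1 h2
    exact ⟨by linarith, by linarith⟩

/-- The matrix `W diag(q) Wᵀ` is an approximate inverse of `A` if `q i * lam i` is close to `1`
for all eigenvalues `lam i` that matter. -/
theorem isApproxInv_of_diagonal {lo hi : ℝ} (hlo : 0 < lo) {M A W : Matrix (Fin n) (Fin n) ℝ}
    {lam q : Fin n → ℝ} (hM : M = W * Wᵀ) (hW : Wᵀ * A * W = Matrix.diagonal lam)
    (hker : ∀ v, M *ᵥ v = 0 ↔ A *ᵥ v = 0)
    (hq : ∀ i, (∀ a, W a i = 0) ∨ (0 < lam i ∧ lo ≤ lam i * q i ∧ lam i * q i ≤ hi)) :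
    IsApproxInv lo hi (W * Matrix.diagonal q * Wᵀ) A := by
  -- Diagonal entries facing a zero column of `W` have no effect, so nothing need be known about `q`
  -- there.
  have hcut : ∀ g : Fin n → ℝ, W * Matrix.diagonal g * Wᵀ =
      W * Matrix.diagonal (fun i => if ∀ a, W a i = 0 then 0 else g i) * Wᵀ := by
    intro g
    congr 1
    ext a i
    rw [Matrix.mul_diagonal, Matrix.mul_diagonal]
    split_ifs with h0
    · rw [h0 a]; ring
    · rfl
  have hpsd : ∀ g : Fin n → ℝ, (∀ i, (∀ a, W a i = 0) ∨ 0 ≤ g i) →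
      (W * Matrix.diagonal g * Wᵀ).PosSemidef := by
    intro g hg
    rw [hcut]
    refine PosSemidef.congr_transpose (Matrix.PosSemidef.diagonal fun i => ?_) W
    simp only [Pi.zero_apply]
    split_ifs with h0
    · exact le_rfl
    · exact (hg i).resolve_left h0
  have hqpos : ∀ i, (∀ a, W a i = 0) ∨ 0 < q i := fun i =>
    (hq i).imp_right fun ⟨h1, h2, _⟩ => (mul_pos_iff_of_pos_left h1).1 (hlo.trans_le h2)
  have hZAZ : W * Matrix.diagonal q * Wᵀ * A * (W * Matrix.diagonal q * Wᵀ) =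
      W * Matrix.diagonal (fun i => q i * (lam i * q i)) * Wᵀ := by
    calc _ = W * (Matrix.diagonal q * ((Wᵀ * A * W) * Matrix.diagonal q)) * Wᵀ := by
          simp only [Matrix.mul_assoc]
      _ = _ := by rw [hW, Matrix.diagonal_mul_diagonal, Matrix.diagonal_mul_diagonal]
  have hsmul : ∀ s : ℝ, s • (W * Matrix.diagonal q * Wᵀ) =
      W * Matrix.diagonal (fun i => s * q i) * Wᵀ := by
    intro s
    rw [← Matrix.smul_mul, ← Matrix.mul_smul, ← Matrix.diagonal_smul]
    rfl
  have hsub : ∀ g g' : Fin n → ℝ, W * Matrix.diagonal g * Wᵀ - W * Matrix.diagonal g' * Wᵀ =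
      W * Matrix.diagonal (fun i => g i - g' i) * Wᵀ := by
    intro g g'
    rw [← Matrix.sub_mul, ← Matrix.mul_sub, Matrix.diagonal_sub]
  refine ⟨hpsd _ fun i => (hqpos i).imp_right le_of_lt, fun v => ?_, ?_, ?_⟩
  · rw [← hker v, hM]
    constructor
    · intro hv
      have h0 : ∑ i, q i * (Wᵀ *ᵥ v) i ^ 2 = 0 := by
        have : v ⬝ᵥ (W * Matrix.diagonal q * Wᵀ) *ᵥ v = 0 := by rw [hv, dotProduct_zero]
        rw [← Matrix.mulVec_mulVec, ← Matrix.mulVec_mulVec, Matrix.dotProduct_mulVec,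
          ← Matrix.mulVec_transpose] at this
        rw [← this]
        simp only [dotProduct, Matrix.mulVec_diagonal]
        exact Finset.sum_congr rfl fun i _ => by ring
      have hz : ∀ i, (∀ a, W a i = 0) → (Wᵀ *ᵥ v) i = 0 := fun i hi => by
        simp [Matrix.mulVec, dotProduct, hi]
      have hnn : ∀ i ∈ Finset.univ, 0 ≤ q i * (Wᵀ *ᵥ v) i ^ 2 := fun i _ => by
        rcases hqpos i with h1 | h1
        · rw [hz i h1]; simp
        · positivity
      have hWv : Wᵀ *ᵥ v = 0 := by
        ext i
        rcases hqpos i with h1 | h1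
        · exact hz i h1
        · have := (Finset.sum_eq_zero_iff_of_nonneg hnn).1 h0 i (Finset.mem_univ i)
          simpa [h1.ne'] using this
      rw [← Matrix.mulVec_mulVec, hWv, Matrix.mulVec_zero]
    · intro hv
      have h0 : (Wᵀ *ᵥ v) ⬝ᵥ (Wᵀ *ᵥ v) = 0 := by
        rw [Matrix.dotProduct_mulVec, Matrix.vecMul_transpose, Matrix.mulVec_mulVec, hv,
          zero_dotProduct]
      rw [← Matrix.mulVec_mulVec, dotProduct_self_eq_zero.1 h0, Matrix.mulVec_zero]
  · rw [hZAZ, hsmul, hsub]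
    refine hpsd _ fun i => ?_
    rcases hqpos i with h1 | h1
    · exact Or.inl h1
    · refine (hq i).imp_right fun h2 => ?_
      nlinarith [h2.2.1]
  · rw [hZAZ, hsmul, hsub]
    refine hpsd _ fun i => ?_
    rcases hqpos i with h1 | h1
    · exact Or.inl h1
    · refine (hq i).imp_right fun h2 => ?_
      nlinarith [h2.2.2]

end Diagonalization

/-! ### Number of rounds and accuracy -/

section Accuracy

/-- The threshold is chosen for the round count: `1.33² (1 - ε) ≥ 1 + ε` holds for `ε` up to about
`0.2777`. -/
theorem two_mul_exp_neg_two_lt : 2 * Real.exp (-2) < 0.2776 := by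
  have h1 : (2.718 : ℝ) < Real.exp 1 := by linarith [Real.exp_one_gt_d9]
  have h2 : Real.exp (-2) * (Real.exp 1 * Real.exp 1) = 1 := by
    rw [← Real.exp_add, ← Real.exp_add]; norm_num
  have h3 : (7.387 : ℝ) < Real.exp 1 * Real.exp 1 := by nlinarith
  nlinarith [Real.exp_pos (-2)]

theorem lamMin_pos : 0 < lamMin := by
  unfold lamMin
  linarith [two_mul_exp_neg_two_lt]

theorem lamMin_lt_lamMax {k : ℝ} (hk : 1 ≤ k) : lamMin < lamMax k := by
  unfold lamMin lamMax
  nlinarith [Real.exp_pos (-2)]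

/-- A lower bound for Chebyshev polynomials outside of `[-1, 1]`. -/
theorem exp_div_two_le_eval_T {y : ℝ} (hy0 : 0 ≤ y) (hy1 : y < 1) (t : ℕ) :
    Real.exp (2 * (t * y)) / 2 ≤
      (Polynomial.Chebyshev.T ℝ (t : ℤ)).eval ((1 + y ^ 2) / (1 - y ^ 2)) := by
  have h1 : 0 < 1 - y := by linarith
  have h2 : 0 < 1 + y := by linarith
  have h3 : 1 - y ^ 2 = (1 - y) * (1 + y) := by ring
  have hcosh : Real.cosh (Real.log ((1 + y) / (1 - y))) = (1 + y ^ 2) / (1 - y ^ 2) := by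
    rw [Real.cosh_log (by positivity), h3]
    field_simp
    ring
  -- First term of the series of `2 artanh y`.
  have hlog : 2 * y ≤ Real.log ((1 + y) / (1 - y)) := by
    have := Real.sum_range_le_log_div hy0 hy1 1
    simp at this
    linarith
  rw [← hcosh, Polynomial.Chebyshev.T_real_cosh, Real.cosh_eq]
  have h4 : Real.exp (2 * (t * y)) ≤ Real.exp (((t : ℤ) : ℝ) * Real.log ((1 + y) / (1 - y))) := by
    apply Real.exp_le_exp.2
    push_cast
    nlinarith [(Nat.cast_nonneg t : (0 : ℝ) ≤ t)]
  linarith [Real.exp_pos (-(((t : ℤ) : ℝ) * Real.log ((1 + y) / (1 - y))))]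

/-- With `y = √(lamMin / lamMax k)` one has `d / c = (1 + y²) / (1 - y²)`. Since `t y ≥ 1`, the
denominator `T_t(d / c)` of the residual is at least `e² / 2`, while the argument of the numerator
lies in `[-1, 1]`. -/
theorem scalarCheby_accuracy {k lam : ℝ} (hk : 1 ≤ k) (h1 : lamMin ≤ lam) (h2 : lam ≤ lamMax k) :
    |1 - lam * (scalarCheby ((lamMax k + lamMin) / 2) ((lamMax k - lamMin) / 2) lam
      (rounds k)).x 0| ≤ 2 * Real.exp (-2) := by
  have hmin := lamMin_pos
  have hlt := lamMin_lt_lamMax hk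
  set a := lamMin with ha
  set b := lamMax k with hb
  have hbpos : 0 < b := hmin.trans hlt
  have hc : 0 < (b - a) / 2 := by linarith
  obtain ⟨y, hy⟩ : ∃ y, y = √(a / b) := ⟨_, rfl⟩
  have hy2 : y ^ 2 = a / b := by rw [hy, Real.sq_sqrt (by positivity)]
  have hy0 : 0 ≤ y := by rw [hy]; positivity
  have hy1 : y < 1 := by
    rw [hy, Real.sqrt_lt' one_pos, div_lt_iff₀ hbpos]
    linarith
  have hθ : ((b + a) / 2) / ((b - a) / 2) = (1 + y ^ 2) / (1 - y ^ 2) := by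
    rw [hy2]
    have : b - a ≠ 0 := by linarith
    field_simp
  have hty : 1 ≤ (rounds k : ℝ) * y := by
    have hkpos : 0 < k := by linarith
    have h5 : (1.33 : ℝ) * √k ≤ rounds k := Nat.le_ceil _
    have h6 : 1 ≤ 1.33 * √k * y := by
      have e : 1.33 * √k * y = √(1.33 ^ 2 * k * (a / b)) := by
        rw [Real.sqrt_mul (by positivity), Real.sqrt_mul (by positivity), ← hy,
          Real.sqrt_sq (by norm_num)]
      -- The factor `k` cancels against the one in `lamMax k`, leaving `1 + ε ≤ 1.33² (1 - ε)` with
      -- `ε = 2e⁻²`.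
      rw [e, Real.one_le_sqrt, mul_div_assoc', le_div_iff₀ hbpos, ha, hb, lamMin, lamMax]
      nlinarith [two_mul_exp_neg_two_lt]
    exact h6.trans (mul_le_mul_of_nonneg_right h5 hy0)
  have hres := scalarCheby_residual hc (by linarith : (b - a) / 2 < (b + a) / 2) lam (rounds k)
  have hT := exp_div_two_le_eval_T hy0 hy1 (rounds k)
  rw [hθ] at hres
  have hT1 : |(Polynomial.Chebyshev.T ℝ (rounds k : ℤ)).eval
      (((b + a) / 2 - lam) / ((b - a) / 2))| ≤ 1 := by
    apply Polynomial.Chebyshev.abs_eval_T_real_le_one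
    rw [abs_div, abs_of_pos hc, div_le_one hc, abs_le]
    constructor <;> linarith
  rw [← hres, abs_mul] at hT1
  have hT2 : Real.exp 2 / 2 ≤ (Polynomial.Chebyshev.T ℝ (rounds k : ℤ)).eval
      ((1 + y ^ 2) / (1 - y ^ 2)) := by
    refine le_trans ?_ hT
    have : Real.exp 2 ≤ Real.exp (2 * (rounds k * y)) := Real.exp_le_exp.2 (by linarith)
    linarith
  rw [abs_of_pos (lt_of_lt_of_le (by positivity) hT2)] at hT1
  have h7 := (mul_le_mul_of_nonneg_left hT2 (abs_nonneg _)).trans hT1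
  rw [Real.exp_neg]
  have h8 := Real.exp_pos 2
  rw [← div_eq_mul_inv, le_div_iff₀ h8]
  linarith

end Accuracy

/-- Chebyshev iteration preconditioned by an approximate inverse of `A` is an approximate inverse
of `A` of accuracy `2e⁻²`. -/
theorem IsApproxInv.exists_precondCheby {n : ℕ} {k : ℝ} (hk : 1 ≤ k)
    {M A : Matrix (Fin n) (Fin n) ℝ} (h : IsApproxInv lamMin (lamMax k) M A) (hA : A.PosSemidef)
    {f : (Fin n → ℝ) → (Fin n → ℝ)} (hf : ∀ b, f b = M *ᵥ b) :
    ∃ Z : Matrix (Fin n) (Fin n) ℝ,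
      (∀ b, precondCheby A b (rounds k) f lamMin (lamMax k) = Z *ᵥ b) ∧
      IsApproxInv (1 - 2 * Real.exp (-2)) (1 + 2 * Real.exp (-2)) Z A := by
  obtain ⟨W, lam, hM, hW, hlam⟩ := h.exists_diagonal hA
  refine ⟨_, fun b => ?_, isApproxInv_of_diagonal (lo := 1 - 2 * Real.exp (-2)) (q := fun i => (scalarCheby
    ((lamMax k + lamMin) / 2) ((lamMax k - lamMin) / 2) (lam i) (rounds k)).x 0)
    -- `lamMin` is by definition the lower accuracy `1 - 2e⁻²`, so its positivity serves for both.
    lamMin_pos hM hW h.ker_iff fun i => ?_⟩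
  · rw [precondCheby, (chebyState_of_diagonal hM hW hf _ _ b _).1, mulVec_diag_mulVec,
      Matrix.mulVec_mulVec]
  · refine (hlam i).imp_right fun hl => ?_
    have := abs_le.1 (scalarCheby_accuracy hk hl.1 hl.2)
    exact ⟨lamMin_pos.trans_le hl.1, by linarith [this.2], by linarith [this.1]⟩

/-! ### Block matrices and partial Cholesky factors -/

section Blocks

theorem PosSemidef.fromBlocks_diagonal {ι κ : Type*} [Fintype ι] [Fintype κ]
    {X : Matrix ι ι ℝ} {Y : Matrix κ κ ℝ} (hX : X.PosSemidef) (hY : Y.PosSemidef) :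
    (Matrix.fromBlocks X 0 0 Y).PosSemidef := by
  refine Matrix.PosSemidef.of_dotProduct_mulVec_nonneg
    (Matrix.IsHermitian.fromBlocks hX.isHermitian (by simp) hY.isHermitian) fun v => ?_
  have h1 := PosSemidef.dotProduct_nonneg hX (v ∘ Sum.inl)
  have h2 := PosSemidef.dotProduct_nonneg hY (v ∘ Sum.inr)
  have : star v ⬝ᵥ Matrix.fromBlocks X 0 0 Y *ᵥ v =
      (v ∘ Sum.inl) ⬝ᵥ X *ᵥ (v ∘ Sum.inl) + (v ∘ Sum.inr) ⬝ᵥ Y *ᵥ (v ∘ Sum.inr) := by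
    simp [Matrix.fromBlocks_mulVec, dotProduct, Fintype.sum_sum_type]
  rw [this]
  exact add_nonneg h1 h2

theorem coreMatrix_mulVec_eq_zero_iff {m r : ℕ} {A : Matrix (Fin r) (Fin r) ℝ}
    (v : Fin m ⊕ Fin r → ℝ) :
    coreMatrix m A *ᵥ v = 0 ↔ v ∘ Sum.inl = 0 ∧ A *ᵥ (v ∘ Sum.inr) = 0 := by
  rw [coreMatrix, Matrix.fromBlocks_mulVec]
  simp only [Matrix.one_mulVec, Matrix.zero_mulVec, add_zero, zero_add, funext_iff, Sum.forall,
    Sum.elim_inl, Sum.elim_inr, Pi.zero_apply]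

/-- On the identity block the differences are `(1 - lo) I` and `(hi - 1) I`; this is where `lo ≤ 1 ≤
hi` enters. -/
theorem IsApproxInv.coreMatrix {lo hi : ℝ} (hlo : lo ≤ 1) (hhi : 1 ≤ hi) {r : ℕ}
    {Z A : Matrix (Fin r) (Fin r) ℝ} (h : IsApproxInv lo hi Z A) (m : ℕ) :
    IsApproxInv lo hi (coreMatrix m Z) (coreMatrix m A) := by
  refine ⟨PosSemidef.fromBlocks_diagonal .one h.posSemidef, fun v => ?_, ?_, ?_⟩
  · rw [coreMatrix_mulVec_eq_zero_iff, coreMatrix_mulVec_eq_zero_iff, h.ker_iff]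
  · convert PosSemidef.fromBlocks_diagonal
      (Matrix.PosSemidef.one.smul (sub_nonneg.2 hlo) : ((1 - lo) • (1 : Matrix (Fin m) _ ℝ)).PosSemidef)
      h.lower using 1
    simp [RecSolver.coreMatrix, Matrix.fromBlocks_multiply, Matrix.fromBlocks_smul, sub_eq_add_neg,
      Matrix.fromBlocks_neg, Matrix.fromBlocks_add, add_smul]
  · convert PosSemidef.fromBlocks_diagonal
      (Matrix.PosSemidef.one.smul (sub_nonneg.2 hhi) : ((hi - 1) • (1 : Matrix (Fin m) _ ℝ)).PosSemidef)
      h.upper using 1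
    simp [RecSolver.coreMatrix, Matrix.fromBlocks_multiply, Matrix.fromBlocks_smul, sub_eq_add_neg,
      Matrix.fromBlocks_neg, Matrix.fromBlocks_add, add_smul]

end Blocks

theorem mul_mul_transpose_of_congruence {ι κ : Type*} [Fintype ι] [Fintype κ] [DecidableEq κ]
    {B : Matrix ι ι ℝ} {C : Matrix κ κ ℝ} {Q : Matrix ι κ ℝ} {Qi : Matrix κ ι ℝ} (hQ : Qi * Q = 1)
    (hB : B = Q * C * Qᵀ) : Qi * B * Qiᵀ = C := by
  have hQt : Qᵀ * Qiᵀ = 1 := by rw [← Matrix.transpose_mul, hQ, Matrix.transpose_one]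
  calc Qi * B * Qiᵀ = (Qi * Q) * C * (Qᵀ * Qiᵀ) := by rw [hB]; simp only [Matrix.mul_assoc]
    _ = C := by rw [hQ, hQt, Matrix.one_mul, Matrix.mul_one]

/-- Approximate inverses transform along a factorization `B = Q C Qᵀ`, up to the orthogonal
projection onto the range of `B`. -/
theorem IsApproxInv.of_congruence {n : ℕ} {κ : Type*} [Fintype κ] [DecidableEq κ] {lo hi : ℝ}
    {B : Matrix (Fin n) (Fin n) ℝ} {C D : Matrix κ κ ℝ} (h : IsApproxInv lo hi D C) (hC : Cᵀ = C)
    {Q : Matrix (Fin n) κ ℝ} {Qi : Matrix κ (Fin n) ℝ} (hQ : Qi * Q = 1) (hB : B = Q * C * Qᵀ) :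
    IsApproxInv lo hi ((B * pinv B) * Qiᵀ * D * Qi * (B * pinv B)) B := by
  have hp := isMoorePenrose_pinv B
  have hBs : Bᵀ = B := by
    rw [hB]; simp [Matrix.transpose_mul, Matrix.mul_assoc, hC]
  obtain ⟨E, hE⟩ : ∃ E, E = B * pinv B := ⟨_, rfl⟩
  have hEs : Eᵀ = E := by rw [hE, hp.symm_left]
  have hEB : E * B = B := by rw [hE, hp.mul_mul_left]
  have hBE : B * E = B := by
    have := congrArg Matrix.transpose hEB
    rwa [Matrix.transpose_mul, hEs, hBs] at this
  rw [← hE]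
  have hQBQ := mul_mul_transpose_of_congruence hQ hB
  -- The projection `E` fixes `B` on both sides and `Qi B Qiᵀ = C`, so the bounds on `DCD` carry
  -- over by congruence with `E Qiᵀ`.
  have hMBM : (E * Qiᵀ * D * Qi * E) * B * (E * Qiᵀ * D * Qi * E) =
      E * Qiᵀ * (D * C * D) * (E * Qiᵀ)ᵀ := by
    rw [Matrix.transpose_mul, Matrix.transpose_transpose, hEs]
    calc _ = E * Qiᵀ * D * (Qi * ((E * B) * E) * Qiᵀ) * D * (Qi * E) := by
          simp only [Matrix.mul_assoc]
      _ = _ := by rw [hEB, hBE, hQBQ]; simp only [Matrix.mul_assoc]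
  have hM : E * Qiᵀ * D * Qi * E = E * Qiᵀ * D * (E * Qiᵀ)ᵀ := by
    rw [Matrix.transpose_mul, Matrix.transpose_transpose, hEs]
    simp only [Matrix.mul_assoc]
  refine ⟨?_, fun v => ⟨fun hv => ?_, fun hv => ?_⟩, ?_, ?_⟩
  · rw [hM]
    exact PosSemidef.congr_transpose h.posSemidef _
  · have h0 : D *ᵥ (Qi *ᵥ (E *ᵥ v)) = 0 := by
      apply PosSemidef.mulVec_eq_zero_of_dotProduct h.posSemidef
      have : v ⬝ᵥ (E * Qiᵀ * D * Qi * E) *ᵥ v = 0 := by rw [hv, dotProduct_zero]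
      simp only [← Matrix.mulVec_mulVec] at this
      rwa [Matrix.dotProduct_mulVec, ← Matrix.mulVec_transpose, hEs, Matrix.dotProduct_mulVec,
        Matrix.vecMul_transpose] at this
    have h1 := (h.ker_iff _).1 h0
    obtain ⟨w, hw⟩ : ∃ w, w = Qᵀ *ᵥ (pinv B *ᵥ v) := ⟨_, rfl⟩
    have hEv : E *ᵥ v = Q *ᵥ (C *ᵥ w) := by
      have hBw : ∀ y, B *ᵥ y = Q *ᵥ (C *ᵥ (Qᵀ *ᵥ y)) := fun y => by
        rw [Matrix.mulVec_mulVec, Matrix.mulVec_mulVec, ← hB]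
      rw [hE, ← Matrix.mulVec_mulVec, hBw, hw]
    rw [hEv, Matrix.mulVec_mulVec _ Qi, hQ, Matrix.one_mulVec] at h1
    have h2 : (C *ᵥ w) ⬝ᵥ (C *ᵥ w) = 0 := by
      rw [Matrix.dotProduct_mulVec, ← Matrix.mulVec_transpose, hC, h1, zero_dotProduct]
    have h3 : E *ᵥ v = 0 := by
      rw [hEv, dotProduct_self_eq_zero.1 h2, Matrix.mulVec_zero]
    rw [← hBE, ← Matrix.mulVec_mulVec, h3, Matrix.mulVec_zero]
  · have h3 : E *ᵥ v = 0 := by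
      have hcomm : E = pinv B * B := by
        rw [← hEs, hE, Matrix.transpose_mul, isSymm_pinv hBs, hBs]
      rw [hcomm, ← Matrix.mulVec_mulVec, hv, Matrix.mulVec_zero]
    rw [← Matrix.mulVec_mulVec, h3, Matrix.mulVec_zero]
  · rw [hMBM, hM]
    convert PosSemidef.congr_transpose h.lower (E * Qiᵀ) using 1
    simp only [Matrix.mul_sub, Matrix.sub_mul, Matrix.mul_smul, Matrix.smul_mul]
  · rw [hMBM, hM]
    convert PosSemidef.congr_transpose h.upper (E * Qiᵀ) using 1
    simp only [Matrix.mul_sub, Matrix.sub_mul, Matrix.mul_smul, Matrix.smul_mul]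

theorem permMatrix_transpose_mul_self {n m r : ℕ} (σ : Fin n ≃ Fin m ⊕ Fin r) :
    (permMatrix σ)ᵀ * permMatrix σ = 1 := by
  ext s u
  rw [Matrix.mul_apply, ← σ.symm.sum_comp]
  simp [permMatrix, Matrix.one_apply, eq_comm]

namespace PartialChol

variable {n r : ℕ} {B : Matrix (Fin n) (Fin n) ℝ} {A₁ : Matrix (Fin r) (Fin r) ℝ}

theorem isUnit_det_L (F : PartialChol B A₁) : IsUnit F.L.det := by
  have h : F.L.det = ∏ a, F.L₁₁ a a := by
    rw [L, lowerMatrix, Matrix.det_fromBlocks_zero₁₂, Matrix.det_one, mul_one]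
    exact Matrix.det_of_isLowerTriangular _ fun a b hab => F.lower a b hab
  rw [h, isUnit_iff_ne_zero]
  exact Finset.prod_ne_zero_iff.2 fun a _ => F.diag_ne_zero a

theorem leftInverse_mul (F : PartialChol B A₁) : (F.L⁻¹ * F.Pᵀ) * (F.P * F.L) = 1 := by
  calc (F.L⁻¹ * F.Pᵀ) * (F.P * F.L) = F.L⁻¹ * (F.Pᵀ * F.P) * F.L := by
        simp only [Matrix.mul_assoc]
    _ = 1 := by
        rw [P, permMatrix_transpose_mul_self, Matrix.mul_one,
          Matrix.nonsing_inv_mul _ F.isUnit_det_L]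

theorem eq_congruence (F : PartialChol B A₁) :
    B = (F.P * F.L) * coreMatrix F.m A₁ * (F.P * F.L)ᵀ := by
  conv_lhs => rw [F.factor]
  rw [Matrix.transpose_mul]
  simp only [P, L, Matrix.mul_assoc]

/-- Undoing the congruence turns `B` into the core matrix, of which `A₁` is a principal block. -/
theorem posSemidef_remainder (F : PartialChol B A₁) (hB : B.PosSemidef) : A₁.PosSemidef := by
  have h1 := PosSemidef.congr_transpose hB (F.L⁻¹ * F.Pᵀ)
  rw [mul_mul_transpose_of_congruence F.leftInverse_mul F.eq_congruence] at h1
  exact h1.submatrix Sum.inr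

/-- Keeping `s₀` and applying `Z` to `s₁` is multiplication by `coreMatrix F.m Z`, so the solver is
the matrix of `IsApproxInv.of_congruence` with `Q = P L` and `Qi = L⁻¹ Pᵀ`. -/
theorem exists_solveWith (F : PartialChol B A₁) (hA : A₁.PosSemidef) {lo hi : ℝ} (hlo : lo ≤ 1)
    (hhi : 1 ≤ hi) {Z : Matrix (Fin r) (Fin r) ℝ} (hZ : IsApproxInv lo hi Z A₁)
    {inner : (Fin r → ℝ) → (Fin r → ℝ)} (hinner : ∀ s, inner s = Z *ᵥ s) :
    ∃ M : Matrix (Fin n) (Fin n) ℝ, (∀ b, F.solveWith inner b = M *ᵥ b) ∧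
      IsApproxInv lo hi M B := by
  refine ⟨_, fun b => ?_, IsApproxInv.of_congruence (hZ.coreMatrix hlo hhi F.m)
    (PosSemidef.transpose_eq (PosSemidef.fromBlocks_diagonal .one hA)) F.leftInverse_mul
    F.eq_congruence⟩
  have hcore : ∀ s : Fin F.m ⊕ Fin r → ℝ,
      Sum.elim (fun a => s (Sum.inl a)) (inner fun a => s (Sum.inr a)) = coreMatrix F.m Z *ᵥ s := by
    intro s
    rw [coreMatrix, Matrix.fromBlocks_mulVec, hinner]
    simp only [Matrix.one_mulVec, Matrix.zero_mulVec, add_zero, zero_add]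
    rfl
  simp only [solveWith, hcore, spanProj_eq_mulVec, Matrix.transpose_mul, Matrix.transpose_transpose,
    Matrix.mulVec_mulVec, Matrix.mul_assoc]

end PartialChol

/-! ### The recursion over the levels -/

namespace PrecondSeq

variable {ℓ : ℕ} {k : ℝ} {S : PrecondSeq ℓ}

theorem posSemidef (hk : 1 ≤ k) (hA : IsSDDM0 (S.A 0))
    (hB : ∀ i < ℓ, S.B i ≼ S.A i ∧ S.A i ≼ k • S.B i) :
    ∀ i ≤ ℓ, (S.A i).PosSemidef ∧ (i < ℓ → (S.B i).PosSemidef) := by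
  have step : ∀ i < ℓ, (S.A i).PosSemidef → (S.B i).PosSemidef := by
    intro i hi h
    have hk0 : 0 < k := by linarith
    -- `B = k⁻¹ (A + (k B - A))`.
    convert (h.add (hB i hi).2).smul (inv_nonneg.2 hk0.le) using 1
    rw [add_sub_cancel, smul_smul, inv_mul_cancel₀ hk0.ne', one_smul]
  intro i
  induction i with
  | zero => exact fun _ => ⟨hA.posSemidef, fun hi => step 0 hi hA.posSemidef⟩
  | succ i ih =>
    intro hi
    have h1 := (S.chol i hi).posSemidef_remainder ((ih (Nat.le_of_succ_le hi)).2 hi)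
    exact ⟨h1, fun hi' => step _ hi' h1⟩

/-- The matrices of the solver at every level, with the accuracy of the inner and of the outer
solver. -/
theorem exists_solve (hk : 1 ≤ k) (hA : IsSDDM0 (S.A 0))
    (hB : ∀ i < ℓ, S.B i ≼ S.A i ∧ S.A i ≼ k • S.B i) (i : ℕ) (hi : i < ℓ) :
    (∃ Z : Matrix (Fin (S.dim (i + 1))) (Fin (S.dim (i + 1))) ℝ,
      (i + 1 = ℓ → Z = pinv (S.A (i + 1))) ∧
      (∀ h : i + 1 < ℓ, ∀ s₁, Z *ᵥ s₁ =
        precondCheby (S.A (i + 1)) s₁ (rounds k) (S.solve k (i + 1) h) lamMin (lamMax k)) ∧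
      IsApproxInv (1 - 2 * Real.exp (-2)) (1 + 2 * Real.exp (-2)) Z (S.A (i + 1))) ∧
    ∃ M : Matrix (Fin (S.dim i)) (Fin (S.dim i)) ℝ, (∀ b, S.solve k i hi b = M *ᵥ b) ∧
      IsApproxInv (1 - 2 * Real.exp (-2)) (1 + 2 * Real.exp (-2)) M (S.B i) := by
  have hpos := posSemidef hk hA hB
  have hlo : 1 - 2 * Real.exp (-2) ≤ 1 := by linarith [Real.exp_pos (-2)]
  have hhi : 1 ≤ 1 + 2 * Real.exp (-2) := by linarith [Real.exp_pos (-2)]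
  -- Induction from the last level upwards, as the solver at level `i` calls the one at level `i +
  -- 1`.
  induction hj : ℓ - i generalizing i with
  | zero => omega
  | succ j ih =>
    have hinner : ∃ Z : Matrix (Fin (S.dim (i + 1))) (Fin (S.dim (i + 1))) ℝ,
        (i + 1 = ℓ → Z = pinv (S.A (i + 1))) ∧
        (∀ h : i + 1 < ℓ, ∀ s₁, Z *ᵥ s₁ =
          precondCheby (S.A (i + 1)) s₁ (rounds k) (S.solve k (i + 1) h) lamMin (lamMax k)) ∧
        IsApproxInv (1 - 2 * Real.exp (-2)) (1 + 2 * Real.exp (-2)) Z (S.A (i + 1)) := by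
      by_cases h : i + 1 < ℓ
      · obtain ⟨-, M, hM, hMB⟩ := ih (i + 1) h (by omega)
        obtain ⟨Z, hZ, hZA⟩ := (hMB.of_sandwich hk ((hpos _ h.le).2 h) (hpos _ h.le).1
          (hB _ h).1 (hB _ h).2).exists_precondCheby hk (hpos _ h.le).1 hM
        exact ⟨Z, fun h' => absurd h' h.ne, fun _ s => (hZ s).symm, hZA⟩
      · exact ⟨_, fun _ => rfl, fun h' => absurd h' h, isApproxInv_pinv hlo hhi (hpos _ hi).1⟩
    refine ⟨hinner, ?_⟩
    obtain ⟨Z, hZ1, hZ2, hZA⟩ := hinner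
    rw [PrecondSeq.solve]
    refine (S.chol i hi).exists_solveWith (hpos _ hi).1 hlo hhi hZA fun s => ?_
    split_ifs with h
    · exact (hZ2 h s).symm
    · rw [hZ1 (by omega)]

end PrecondSeq

end RecSolver

/-- `B i` and `solve k i` stand for `B_{i+1}` and `Solve_{B_{i+1}}`, so that `i < ℓ` here is
`1 ≤ i + 1 ≤ ℓ`, and `Z` is the matrix `Z_{i+1}`. -/
theorem lemma5p3 (ℓ : ℕ) (k : ℝ) (hk : 1 ≤ k) (S : PrecondSeq ℓ)
    (hA : IsSDDM0 (S.A 0)) (hirr : ¬ IsReducible (S.A 0))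
    (hB : ∀ i < ℓ, S.B i ≼ S.A i ∧ S.A i ≼ k • S.B i) (i : ℕ) (hi : i < ℓ) :
    IsSymmLinearOp (S.solve k i hi) ∧
    IsSymmLinearOp
      (fun b => precondCheby (S.A i) b (rounds k) (S.solve k i hi) lamMin (lamMax k)) ∧
    (∃ Z : Matrix (Fin (S.dim (i + 1))) (Fin (S.dim (i + 1))) ℝ,
      (i + 1 = ℓ → Z = pinv (S.A (i + 1))) ∧
      (∀ h : i + 1 < ℓ, ∀ s₁, Z *ᵥ s₁ =
        precondCheby (S.A (i + 1)) s₁ (rounds k) (S.solve k (i + 1) h) lamMin (lamMax k)) ∧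
      (1 - 2 * Real.exp (-2)) • pinv Z ≼ S.A (i + 1) ∧
      S.A (i + 1) ≼ (1 + 2 * Real.exp (-2)) • pinv Z) ∧
    (∃ M : Matrix (Fin (S.dim i)) (Fin (S.dim i)) ℝ,
      (∀ b, M *ᵥ b = S.solve k i hi b) ∧
      (1 - 2 * Real.exp (-2)) • pinv M ≼ S.B i ∧
      S.B i ≼ (1 + 2 * Real.exp (-2)) • pinv M) := by
  have hpos := PrecondSeq.posSemidef hk hA hB
  obtain ⟨⟨Z, hZ1, hZ2, hZA⟩, M, hM, hMB⟩ := PrecondSeq.exists_solve hk hA hB i hi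
  obtain ⟨hApos, hBpos⟩ := hpos i hi.le
  obtain ⟨Y, hY, hYA⟩ := (hMB.of_sandwich hk (hBpos hi) hApos
    (hB i hi).1 (hB i hi).2).exists_precondCheby hk hApos hM
  exact ⟨⟨M, PosSemidef.transpose_eq hMB.posSemidef, hM⟩,
    ⟨Y, PosSemidef.transpose_eq hYA.posSemidef, hY⟩,
    ⟨Z, hZ1, hZ2, hZA.loewner_pinv (PosSemidef.transpose_eq (hpos _ hi).1)⟩,
    ⟨M, fun b => (hM b).symm, hMB.loewner_pinv (PosSemidef.transpose_eq (hBpos hi))⟩⟩
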